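/- All groups are finite abelian groups. A map $\varphi:G_1\to G_2$ with $|G_2|=|G_1|+1$ is \emph{circular Costas} if $\varphi$ is injective and, for every $k\in G_1\setminus\{0\}$, the map $i\mapsto \varphi(i+k)-\varphi(i)$ is injective; it is \emph{standard} if moreover $\varphi(G_1)=G_2\setminus\{0\}$. Its \emph{order} is $|G_2|$. Maps $\varphi_1:G_1\to G_2$ and $\varphi_2:H_1\to H_2$ are \emph{equivalent} if there are group isomorphisms $\psi_1:G_1\to H_1$ and $\psi_2:G_2\to H_2$ such that $\varphi_1(x)=y\iff\varphi_2(\psi_1(x))=\psi_2(y)$ for all $x\in G_1$, $y\in G_2$. Let $\mathbb{F}_q$ be the finite field with $q$ elements. A polynomial $f\in\mathbb{F}_q[x]$ is a \emph{Costas polynomial} if $f(0)=0$ and $x\mapsto f(dx)-f(x)$ is a permutation of $\mathbb{F}_q$ for all $d\in\mathbb{F}_q$, $d\neq 1$; a map is equivalent to $f$ if it is equivalent to the map $(\mathbb{F}_q^*,\times)\to(\mathbb{F}_q,+)$, $x\mapsto f(x)$. Let $q$ be a prime power. (1) Let $\varphi:G_1\to G_2$ be a standard circular Costas map of order $q$.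 Then $\varphi$ is equivalent to some Costas polynomial $f\in\mathbb{F}_q[x]$ if and only if $G_1$ is cyclic. (2) Let $\psi_1:G_1\to(\mathbb{F}_q^*,\times)$ and $\psi_2:G_2\to(\mathbb{F}_q,+)$ be any group isomorphisms. Then there is a bijection $\varphi\mapsto f_\varphi$ from the set of standard circular Costas maps $G_1\to G_2$ (of order $q$, with the cyclic domain $G_1$) onto the set of Costas polynomials in $\mathbb{F}_q[x]$ of degree at most $q-1$, such that $\varphi(i)=j\iff f_\varphi(\psi_1(i))=\psi_2(j)$ for all $i\in G_1$, $j\in G_2$. -/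

import Mathlib

namespace Costas

/-- A map `φ : G₁ → G₂` between finite abelian groups with `|G₁| + 1 = |G₂|` is circular Costas
if it is injective and all its difference maps `i ↦ φ (i + k) - φ i`, `k ≠ 0`, are injective. -/
structure IsCircularCostas {G₁ G₂ : Type*} [AddCommGroup G₁] [AddCommGroup G₂]
    [Finite G₁] [Finite G₂] (φ : G₁ → G₂) : Prop where
  card_eq : Nat.card G₁ + 1 = Nat.card G₂
  injective : Function.Injective φ
  injective_diff : ∀ k : G₁, k ≠ 0 → Function.Injective (fun i : G₁ => φ (i + k) - φ i)

/-- A circular Costas map is standard if its image is `G₂ \ {0}`. -/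
structure IsStandardCircularCostas {G₁ G₂ : Type*} [AddCommGroup G₁] [AddCommGroup G₂]
    [Finite G₁] [Finite G₂] (φ : G₁ → G₂) : Prop extends IsCircularCostas φ where
  range_eq : Set.range φ = {y : G₂ | y ≠ 0}

/-- The order of a circular Costas map `φ : G₁ → G₂` is `|G₂|`. (If `G₂ ≅ (ℤ/p)^m` this is
`p ^ m`; that `G₂` has this form is not part of the definition.) -/
noncomputable def order {G₁ G₂ : Type*} (_φ : G₁ → G₂) : ℕ := Nat.card G₂

/-- Equivalence of two maps between abelian groups:
`φ₁ x = y ↔ φ₂ (ψ₁ x) = ψ₂ y` for some group isomorphisms `ψ₁`, `ψ₂`. -/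
def Equivalent {G₁ G₂ H₁ H₂ : Type*} [AddCommGroup G₁] [AddCommGroup G₂]
    [AddCommGroup H₁] [AddCommGroup H₂] (φ₁ : G₁ → G₂) (φ₂ : H₁ → H₂) : Prop :=
  ∃ (ψ₁ : G₁ ≃+ H₁) (ψ₂ : G₂ ≃+ H₂), ∀ (x : G₁) (y : G₂), φ₁ x = y ↔ φ₂ (ψ₁ x) = ψ₂ y

/-- `f` is a Costas polynomial over the (finite) field `F` if `f(0) = 0` and `f(dx) - f(x)` is a
permutation of `F` for all `d ≠ 1` (the case `d = 0` included). -/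
structure IsCostasPolynomial {F : Type*} [Field F] (f : Polynomial F) : Prop where
  eval_zero : f.eval 0 = 0
  bijective_diff : ∀ d : F, d ≠ 1 → Function.Bijective (fun x : F => f.eval (d * x) - f.eval x)

/-- The map `(Fˣ, ×) → (F, +)` given by a polynomial, with the group `Fˣ` written additively. -/
def unitsMap {F : Type*} [Field F] (f : Polynomial F) : Additive Fˣ → F :=
  fun u => f.eval ((Additive.toMul u : Fˣ) : F)

/-- The standard circular Costas maps `G₁ → G₂` of order `q`. -/
def standardMaps (G₁ G₂ : Type*) [AddCommGroup G₁] [AddCommGroup G₂]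
    [Finite G₁] [Finite G₂] (q : ℕ) : Set (G₁ → G₂) :=
  {φ | IsStandardCircularCostas φ ∧ order φ = q}

/-- The Costas polynomials over `F` of degree at most `n`. -/
def costasPolynomials (F : Type*) [Field F] (n : ℕ) : Set (Polynomial F) :=
  {f | IsCostasPolynomial f ∧ f.natDegree ≤ n}

end Costas

/-! Fix isomorphisms of `G₁` with the unit group and of `G₂` with `(F, +)`. Translation by `k`
becomes multiplication by some `d ≠ 1`, so extending by `0 ↦ 0` and interpolating turns standard
circular Costas maps into Costas polynomials and back; below degree `|F|` the polynomial is unique.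
This gives (2). For (1), `Fˣ` is cyclic, and what remains is that `G₂` is elementary abelian. In the
group ring of `G₁ × G₂` over `ZMod p`, let `D` be the sum over the graph of `φ` and `E` that over
its negatives. The Costas property evaluates `D * E`, and iterating gives `D ^ p * E = B`, the sum
of `G₁ × (G₂ \ {0})`. By Frobenius, `D ^ p * E` is a sum of `|G₁|²` group elements, exactly enough
to cover the support of `B`. If `p • y ≠ 0` for some `y`, one term falls outside that support, and
too few are left. -/

namespace Costas

/-! ### Polynomials as functions on a finite field -/

section Interpolation

variable {F : Type*} [Field F] [Finite F]

/-- Every self-map of a finite field is given by a polynomial of degree less than `|F|`. -/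
lemma exists_polynomial_eval_eq (g : F → F) :
    ∃ f : Polynomial F, f.natDegree ≤ Nat.card F - 1 ∧ ∀ x, f.eval x = g x := by
  classical
  cases nonempty_fintype F
  have hinj : Set.InjOn (id : F → F) (Finset.univ : Finset F) := Function.injective_id.injOn
  refine ⟨Lagrange.interpolate Finset.univ id g, ?_, fun x => ?_⟩
  · rw [Nat.card_eq_fintype_card]
    exact Polynomial.natDegree_le_of_degree_le (Lagrange.degree_interpolate_le g hinj)
  · exact Lagrange.eval_interpolate_at_node g hinj (Finset.mem_univ x)

/-- A polynomial of degree less than `|F|` is determined by its values. -/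
lemma polynomial_ext_of_natDegree_le {f g : Polynomial F} (hf : f.natDegree ≤ Nat.card F - 1)
    (hg : g.natDegree ≤ Nat.card F - 1) (h : ∀ x, f.eval x = g.eval x) : f = g := by
  cases nonempty_fintype F
  have key : ∀ f : Polynomial F, f.natDegree ≤ Nat.card F - 1 →
      f.degree < (Finset.univ : Finset F).card := by
    intro f hf
    refine Polynomial.degree_le_natDegree.trans_lt ?_
    rw [Nat.card_eq_fintype_card] at hf
    have : 0 < Fintype.card F := Fintype.card_pos
    rw [Finset.card_univ, Nat.cast_lt]
    omega
  exact Polynomial.eq_of_degrees_lt_of_eval_finset_eq Finset.univ (key f hf) (key g hg)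
    fun x _ => h x

end Interpolation

/-! ### Costas polynomials versus standard circular Costas maps -/

section Correspondence

variable {F : Type*} [Field F]
  {G₁ G₂ : Type*} [AddCommGroup G₁] [AddCommGroup G₂] [Finite G₁] [Finite G₂]

/-- For `d = 0` the difference map is `x ↦ -f(x)`. -/
lemma IsCostasPolynomial.injective_eval {f : Polynomial F} (hf : IsCostasPolynomial f) :
    Function.Injective (fun x : F => f.eval x) := by
  intro x y hxy
  apply (hf.bijective_diff 0 zero_ne_one).1
  simpa [hf.eval_zero] using hxy

/-- The map `G₁ → G₂` obtained from a polynomial by transport along `ψ₁` and `ψ₂`. -/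
def transportedMap (ψ₁ : G₁ ≃+ Additive Fˣ) (ψ₂ : G₂ ≃+ F) (f : Polynomial F) : G₁ → G₂ :=
  fun i => ψ₂.symm (unitsMap f (ψ₁ i))

variable [Finite F]

lemma IsCostasPolynomial.isStandardCircularCostas {f : Polynomial F} (hf : IsCostasPolynomial f)
    (ψ₁ : G₁ ≃+ Additive Fˣ) (ψ₂ : G₂ ≃+ F) :
    IsStandardCircularCostas (transportedMap ψ₁ ψ₂ f) where
  card_eq := by
    rw [Nat.card_congr ψ₁.toEquiv, Nat.card_congr ψ₂.toEquiv,
      Nat.card_congr (Additive.toMul (α := Fˣ)), Nat.card_units]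
    have : 0 < Nat.card F := Nat.card_pos
    omega
  injective := by
    intro i j h
    have h1 := hf.injective_eval (ψ₂.symm.injective h)
    exact ψ₁.injective (Additive.toMul.injective (Units.ext h1))
  injective_diff := by
    intro k hk i j h
    have hd : ((Additive.toMul (ψ₁ k) : Fˣ) : F) ≠ 1 := by
      intro h1
      have h2 : Additive.toMul (ψ₁ k) = Additive.toMul (0 : Additive Fˣ) := Units.ext h1
      exact hk (ψ₁.injective ((Additive.toMul.injective h2).trans (map_zero ψ₁).symm))
    have h1 : ψ₂.symm (unitsMap f (ψ₁ (i + k)) - unitsMap f (ψ₁ i)) =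
        ψ₂.symm (unitsMap f (ψ₁ (j + k)) - unitsMap f (ψ₁ j)) := by
      rw [map_sub, map_sub]
      exact h
    have h2 := ψ₂.symm.injective h1
    simp only [unitsMap, map_add, toMul_add, Units.val_mul, mul_comm _
      ((Additive.toMul (ψ₁ k) : Fˣ) : F)] at h2
    have h3 := (hf.bijective_diff _ hd).1 h2
    exact ψ₁.injective (Additive.toMul.injective (Units.ext h3))
  range_eq := by
    ext y
    simp only [Set.mem_range, Set.mem_ofPred_eq]
    constructor
    · rintro ⟨i, rfl⟩ h0
      rw [transportedMap, EmbeddingLike.map_eq_zero_iff] at h0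
      have h1 : ((Additive.toMul (ψ₁ i) : Fˣ) : F) = 0 :=
        hf.injective_eval (h0.trans hf.eval_zero.symm)
      exact (Additive.toMul (ψ₁ i)).ne_zero h1
    · intro hy
      obtain ⟨x, hx⟩ := (Finite.injective_iff_surjective.1 hf.injective_eval) (ψ₂ y)
      have hx0 : x ≠ 0 := by
        rintro rfl
        simp only [hf.eval_zero] at hx
        exact hy ((EmbeddingLike.map_eq_zero_iff).1 hx.symm)
      refine ⟨ψ₁.symm (Additive.ofMul (Units.mk0 x hx0)), ?_⟩
      simp [transportedMap, unitsMap, hx]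

lemma IsStandardCircularCostas.ne_zero {φ : G₁ → G₂} (hφ : IsStandardCircularCostas φ) (i : G₁) :
    φ i ≠ 0 :=
  hφ.range_eq.subset (Set.mem_range_self i)

/-- Standardness makes the value `0` at `0` compatible with injectivity on all of `F`, which settles
`d = 0`; for other `d ≠ 1` the difference conditions of `φ` apply. -/
lemma IsStandardCircularCostas.exists_isCostasPolynomial {φ : G₁ → G₂}
    (hφ : IsStandardCircularCostas φ) (ψ₁ : G₁ ≃+ Additive Fˣ) (ψ₂ : G₂ ≃+ F) :
    ∃ f : Polynomial F, IsCostasPolynomial f ∧ f.natDegree ≤ Nat.card F - 1 ∧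
      transportedMap ψ₁ ψ₂ f = φ := by
  classical
  obtain ⟨f, hdeg, hf⟩ := exists_polynomial_eval_eq (fun x : F => if hx : x = 0 then 0 else
    ψ₂ (φ (ψ₁.symm (Additive.ofMul (Units.mk0 x hx)))))
  have h0 : f.eval 0 = 0 := by simp [hf]
  have hu : ∀ u : Fˣ, f.eval (u : F) = ψ₂ (φ (ψ₁.symm (Additive.ofMul u))) := by
    intro u
    rw [hf, dif_neg u.ne_zero, Units.mk0_val]
  have hne : ∀ u : Fˣ, f.eval (u : F) ≠ 0 := by
    intro u
    rw [hu]
    exact (EmbeddingLike.map_ne_zero_iff).2 (hφ.ne_zero _)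
  refine ⟨f, ⟨h0, fun d hd => ?_⟩, hdeg, ?_⟩
  · rw [← Finite.injective_iff_bijective]
    have hinj : ∀ u v : Fˣ, f.eval (u : F) = f.eval (v : F) → u = v := by
      intro u v h
      rw [hu, hu] at h
      exact Additive.ofMul.injective (ψ₁.symm.injective (hφ.injective (ψ₂.injective h)))
    -- it suffices to separate `0` from the units and the units from each other
    suffices key : (∀ u : Fˣ, f.eval (d * u) - f.eval (u : F) ≠ 0) ∧
        ∀ u v : Fˣ, f.eval (d * u) - f.eval (u : F) = f.eval (d * v) - f.eval (v : F) → u = v by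
      intro x y hxy
      simp only at hxy
      rcases eq_or_ne x 0 with rfl | hx <;> rcases eq_or_ne y 0 with rfl | hy
      · rfl
      · rw [mul_zero, sub_self] at hxy
        exact absurd hxy.symm (key.1 (Units.mk0 y hy))
      · rw [mul_zero, sub_self] at hxy
        exact absurd hxy (key.1 (Units.mk0 x hx))
      · exact congrArg Units.val (key.2 (Units.mk0 x hx) (Units.mk0 y hy) hxy)
    rcases eq_or_ne d 0 with rfl | hd0
    · simp only [zero_mul, h0, zero_sub, neg_inj, ne_eq, neg_eq_zero]
      exact ⟨hne, hinj⟩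
    · obtain ⟨e, rfl⟩ : ∃ e : Fˣ, (e : F) = d := ⟨Units.mk0 d hd0, rfl⟩
      have he : e ≠ 1 := fun h => hd (by rw [h, Units.val_one])
      refine ⟨fun u h => he ?_, fun u v h => ?_⟩
      · rw [sub_eq_zero, ← Units.val_mul] at h
        exact mul_eq_right.1 (hinj _ _ h)
      · rw [← Units.val_mul, ← Units.val_mul, hu, hu, hu, hu, ← map_sub, ← map_sub,
          mul_comm e, mul_comm e, ofMul_mul, ofMul_mul, map_add, map_add] at h
        have hk : ψ₁.symm (Additive.ofMul e) ≠ 0 := by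
          rw [EmbeddingLike.map_ne_zero_iff]
          exact fun h => he (Additive.ofMul.injective h)
        exact Additive.ofMul.injective
          (ψ₁.symm.injective (hφ.injective_diff _ hk (ψ₂.injective h)))
  · funext i
    simp [transportedMap, unitsMap, hu]

end Correspondence

/-! ### The order of `G₂` forces its exponent -/

section GroupRing

open AddMonoidAlgebra

variable {G₁ G₂ : Type*} [AddCommGroup G₁] [AddCommGroup G₂] [Finite G₁] [Finite G₂]

instance charP_addMonoidAlgebra_zmod (p : ℕ) [Fact p.Prime] (G : Type*) [AddCommGroup G] :
    CharP (AddMonoidAlgebra (ZMod p) G) p :=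
  charP_of_injective_algebraMap (algebraMap (ZMod p) (AddMonoidAlgebra (ZMod p) G)).injective p

/-- In the group ring of `G₁ × G₂` over a commutative ring of characteristic `p ∣ |G₂|`, let `D` be
the graph of a standard circular Costas map and `E` its inverse. Then `D ^ p * E` is the sum of all
elements with nonzero second component. -/
lemma IsStandardCircularCostas.graph_pow_mul_inv [Fintype G₁] [Fintype G₂] [DecidableEq G₂]
    {φ : G₁ → G₂} (hφ : IsStandardCircularCostas φ) {p : ℕ} [Fact p.Prime]
    (hp : p ∣ Nat.card G₂) :
    (∑ i, single (i, φ i) 1 : AddMonoidAlgebra (ZMod p) (G₁ × G₂)) ^ p *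
        ∑ j, single (-j, -φ j) 1 =
      ∑ k, ∑ y ∈ Finset.univ.erase (0 : G₂), single (k, y) 1 := by
  classical
  have hcard : ((Fintype.card G₁ : ℕ) : AddMonoidAlgebra (ZMod p) (G₁ × G₂)) = -1 := by
    rw [eq_neg_iff_add_eq_zero, ← Nat.cast_one, ← Nat.cast_add, ← Nat.card_eq_fintype_card,
      hφ.card_eq, CharP.cast_eq_zero_iff _ p]
    exact hp
  have himage : Finset.univ.image φ = Finset.univ.erase 0 := by
    ext y
    have := Set.ext_iff.1 hφ.range_eq y
    simpa using this
  have hsum : ∀ k : G₁, ∑ i, (single (k, φ i) 1 : AddMonoidAlgebra (ZMod p) (G₁ × G₂)) =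
      ∑ y ∈ Finset.univ.erase (0 : G₂), single (k, y) 1 := by
    intro k
    rw [← himage, Finset.sum_image hφ.injective.injOn]
  have hdiff : ∀ k : G₁, k ≠ 0 → Finset.univ.image (fun i => φ (i + k) - φ i) =
      Finset.univ.erase 0 := by
    intro k hk
    apply Finset.eq_of_subset_of_card_le
    · intro y hy
      obtain ⟨i, -, rfl⟩ := Finset.mem_image.1 hy
      simp only [Finset.mem_erase, Finset.mem_univ, and_true, ne_eq, sub_eq_zero]
      exact fun h => hk (by simpa using hφ.injective h)
    -- `G₂ \ {0}` is the image of `φ`, so it has at most `|G₁|` elements.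
    · rw [Finset.card_image_of_injective _ (hφ.injective_diff k hk), ← himage]
      exact Finset.card_image_le
  set D : AddMonoidAlgebra (ZMod p) (G₁ × G₂) := ∑ i, single (i, φ i) 1 with hD
  set E : AddMonoidAlgebra (ZMod p) (G₁ × G₂) := ∑ j, single (-j, -φ j) 1 with hE
  set B : AddMonoidAlgebra (ZMod p) (G₁ × G₂) :=
    ∑ k, ∑ y ∈ Finset.univ.erase (0 : G₂), single (k, y) 1 with hB
  set A : AddMonoidAlgebra (ZMod p) (G₁ × G₂) := ∑ k, ∑ y, single (k, y) 1 with hA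
  set A₁ : AddMonoidAlgebra (ZMod p) (G₁ × G₂) := ∑ k, single (k, 0) 1 with hA₁
  set A₂ : AddMonoidAlgebra (ZMod p) (G₁ × G₂) := ∑ y, single (0, y) 1 with hA₂
  have hAB : B + A₁ = A := by
    rw [hA, hB, hA₁, ← Finset.sum_add_distrib]
    exact Finset.sum_congr rfl fun k _ => Finset.sum_erase_add _ _ (Finset.mem_univ _)
  have hDA₁ : D * A₁ = B := by
    simp only [hD, hA₁, hB, Finset.sum_mul_sum, single_mul_single, Prod.mk_add_mk, add_zero,
      mul_one]
    trans ∑ i, ∑ k, single (k, φ i) 1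
    · exact Finset.sum_congr rfl fun i _ =>
        Equiv.sum_comp (Equiv.addLeft i) fun k => single (k, φ i) (1 : ZMod p)
    · rw [Finset.sum_comm]
      exact Finset.sum_congr rfl fun k _ => hsum k
  have hDA₂ : D * A₂ = A := by
    simp only [hD, hA₂, hA, Finset.sum_mul_sum, single_mul_single, Prod.mk_add_mk, add_zero,
      mul_one]
    exact Finset.sum_congr rfl fun i _ =>
      Equiv.sum_comp (Equiv.addLeft (φ i)) fun y => single (i, y) (1 : ZMod p)
  have hDA : D * A = -A := by
    have h1 : ∀ i : G₁, single (i, φ i) 1 * A = A := by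
      intro i
      simp only [hA, Finset.mul_sum, single_mul_single, Prod.mk_add_mk, mul_one]
      rw [← Equiv.sum_comp (Equiv.addLeft i) fun k => ∑ y : G₂, single (k, y) (1 : ZMod p)]
      exact Finset.sum_congr rfl fun k _ =>
        Equiv.sum_comp (Equiv.addLeft (φ i)) fun y => single (i + k, y) (1 : ZMod p)
    rw [hD, Finset.sum_mul, Finset.sum_congr rfl fun i _ => h1 i, Finset.sum_const,
      Finset.card_univ, nsmul_eq_mul, hcard, neg_one_mul]
  -- Sorted by the difference `k`: each `k ≠ 0` yields every nonzero `y` once, while `k = 0` yields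
  -- the identity `|G₁| = -1` times.
  have hDE : D * E = B - A₂ := by
    have h1 : D * E = ∑ k, ∑ j, single (k, φ (j + k) - φ j) 1 := by
      rw [mul_comm, Finset.sum_comm]
      simp only [hD, hE, Finset.sum_mul_sum, single_mul_single, Prod.mk_add_mk, mul_one]
      refine Finset.sum_congr rfl fun j _ => ?_
      rw [← Equiv.sum_comp (Equiv.addLeft j)]
      simp [sub_eq_neg_add]
    rw [h1, hB, ← Finset.add_sum_erase _ _ (Finset.mem_univ (0 : G₁)),
      ← Finset.add_sum_erase _ (fun k => ∑ y ∈ _, single (k, y) (1 : ZMod p))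
        (Finset.mem_univ (0 : G₁)), add_sub_right_comm]
    congr 1
    · rw [hA₂, ← Finset.sum_erase_add _ _ (Finset.mem_univ (0 : G₂)), sub_add_cancel_left]
      simp only [add_zero, sub_self, Finset.sum_const, Finset.card_univ, nsmul_eq_mul, hcard]
      rw [neg_one_mul]
    · refine Finset.sum_congr rfl fun k hk => ?_
      rw [← hdiff k (Finset.ne_of_mem_erase hk),
        Finset.sum_image (hφ.injective_diff k (Finset.ne_of_mem_erase hk)).injOn]
  -- The exponent starts at `2` because `D * E` contains `A₂`, which one more factor `D` turns into
  -- `A`.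
  have hpow : ∀ m : ℕ, D ^ (m + 2) * E = (-1) ^ (m + 1) * (B + ((m + 2 : ℕ) : _) * A) := by
    intro m
    have hDB : D * B = -A - B := by
      rw [eq_sub_iff_add_eq, ← hDA, ← hAB, mul_add, hDA₁]
    induction m with
    | zero =>
      rw [zero_add, pow_two, mul_assoc, hDE, mul_sub, hDB, hDA₂]
      push_cast
      ring
    | succ m ih =>
      rw [show m + 1 + 2 = (m + 2) + 1 by ring, pow_succ', mul_assoc, ih, mul_left_comm, mul_add,
        mul_left_comm D, hDB, hDA]
      push_cast
      ring
  have h2 := (Fact.out : p.Prime).two_le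
  have := hpow (p - 2)
  rw [show p - 2 + 2 = p by omega, CharP.cast_eq_zero, zero_mul, add_zero] at this
  rw [this]
  -- Cancelling a sign in `(-1) ^ p = -1` also covers `p = 2`.
  have h1 : (-1 : AddMonoidAlgebra (ZMod p) (G₁ × G₂)) ^ (p - 2 + 1) = 1 := by
    have h3 := neg_one_pow_expChar (AddMonoidAlgebra (ZMod p) (G₁ × G₂)) p
    have h4 : (-1 : AddMonoidAlgebra (ZMod p) (G₁ × G₂)) ^ p = _ :=
      congrArg _ (show p = p - 2 + 1 + 1 by omega)
    rw [h3, pow_succ, mul_neg_one, neg_inj] at h4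
    exact h4.symm
  rw [h1, one_mul]

/-- The codomain of a standard circular Costas map is annihilated by every prime dividing its
order. -/
lemma IsStandardCircularCostas.nsmul_eq_zero {φ : G₁ → G₂} (hφ : IsStandardCircularCostas φ)
    {p : ℕ} (hpp : p.Prime) (hp : p ∣ Nat.card G₂) (y : G₂) : p • y = 0 := by
  classical
  cases nonempty_fintype G₁
  cases nonempty_fintype G₂
  have : Fact p.Prime := ⟨hpp⟩
  have hne : ∀ z : G₂, z ≠ 0 → ∃ i, φ i = z := fun z hz => hφ.range_eq.symm.subset hz
  by_contra hy
  obtain ⟨i₀, hi₀⟩ := hne y (fun h => hy (by rw [h, smul_zero]))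
  obtain ⟨j₀, hj₀⟩ := hne _ hy
  -- the map whose fibres are counted by the coefficients of `D ^ p * E`
  let N : G₁ × G₁ → G₁ × G₂ := fun x => (p • x.1 - x.2, p • φ x.1 - φ x.2)
  have hsurj : ∀ k : G₁, ∀ z : G₂, z ≠ 0 → (k, z) ∈ Finset.univ.image N := by
    intro k z hz
    by_contra hmem
    -- By Frobenius, an element missed by `N` has coefficient `0` on the left, but `1` on the right
    -- as `z ≠ 0`.
    have h := hφ.graph_pow_mul_inv hp
    rw [sum_pow_char p, Finset.sum_mul_sum, ← Finset.sum_product',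
      ← Finset.sum_product'] at h
    have h1 := congrArg (fun a => a.coeff (k, z)) h
    simp only [single_pow, single_mul_single, coeff_sum, Finsupp.finsetSum_apply, coeff_single,
      Finsupp.single_apply] at h1
    rw [Finset.sum_eq_zero, Finset.sum_eq_single (k, z)] at h1
    · simp at h1
    · intro b _ hb
      exact if_neg hb
    · intro h2
      simp [hz] at h2
    · intro x _
      refine if_neg fun h2 => hmem (Finset.mem_image.2 ⟨x, Finset.mem_univ _, ?_⟩)
      rw [← h2]
      simp [N, sub_eq_add_neg]
  have hcard : (Finset.univ.erase (0 : G₂)).card = Fintype.card G₁ := by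
    have := hφ.card_eq
    rw [Nat.card_eq_fintype_card, Nat.card_eq_fintype_card] at this
    rw [Finset.card_erase_of_mem (Finset.mem_univ _), Finset.card_univ]
    omega
  -- The second component of `N (i₀, j₀)` is `p • y - p • y = 0`, so the image of `N` would have at
  -- least `|G₁|² + 1` elements.
  have hsub : insert (N (i₀, j₀)) (Finset.univ ×ˢ Finset.univ.erase (0 : G₂)) ⊆
      Finset.univ.image N := by
    intro x hx
    rcases Finset.mem_insert.1 hx with rfl | hx
    · exact Finset.mem_image_of_mem _ (Finset.mem_univ _)
    · exact hsurj x.1 x.2 (by simpa using hx)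
  have h1 := (Finset.card_le_card hsub).trans Finset.card_image_le
  rw [Finset.card_insert_of_notMem (by simp [N, hi₀, hj₀]), Finset.card_product, hcard,
    Finset.card_univ, Finset.card_univ, Fintype.card_prod] at h1
  omega

end GroupRing

/-! ### Identifying `G₂` with `(F, +)` -/

/-- Finite vector spaces of the same cardinality over a field are isomorphic. -/
lemma nonempty_linearEquiv_of_card_eq (K V W : Type*) [Field K] [Finite K] [AddCommGroup V]
    [Finite V] [AddCommGroup W] [Finite W] [Module K V] [Module K W]
    (hcard : Nat.card V = Nat.card W) : Nonempty (V ≃ₗ[K] W) := by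
  rw [Module.natCard_eq_pow_finrank (K := K) (V := V),
    Module.natCard_eq_pow_finrank (K := K) (V := W)] at hcard
  exact ⟨LinearEquiv.ofFinrankEq V W (Nat.pow_right_injective Finite.one_lt_card hcard)⟩

/-- A finite group annihilated by the characteristic of a finite field of the same order is
isomorphic to the additive group of the field. -/
lemma nonempty_addEquiv_of_nsmul_eq_zero {F G : Type*} [Field F] [Finite F] [AddCommGroup G]
    [Finite G] {p : ℕ} [Fact p.Prime] [CharP F p] (hG : ∀ y : G, p • y = 0)
    (hcard : Nat.card G = Nat.card F) : Nonempty (G ≃+ F) := by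
  let _ : Module (ZMod p) G := AddCommGroup.zmodModule hG
  let _ : Algebra (ZMod p) F := ZMod.algebra F p
  exact (nonempty_linearEquiv_of_card_eq (ZMod p) G F hcard).map LinearEquiv.toAddEquiv

end Costas

theorem mainTheorem8 {F : Type*} [Field F] [Finite F] (q : ℕ) (hq : Nat.card F = q)
    {G₁ G₂ : Type*} [AddCommGroup G₁] [AddCommGroup G₂] [Finite G₁] [Finite G₂] :
    (∀ φ : G₁ → G₂, Costas.IsStandardCircularCostas φ → Costas.order φ = q →
      ((∃ f : Polynomial F, Costas.IsCostasPolynomial f ∧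
          Costas.Equivalent φ (Costas.unitsMap f)) ↔ IsAddCyclic G₁)) ∧
    (∀ (ψ₁ : G₁ ≃+ Additive Fˣ) (ψ₂ : G₂ ≃+ F),
      ∃ e : Costas.standardMaps G₁ G₂ q ≃ Costas.costasPolynomials F (q - 1),
        ∀ (φ : Costas.standardMaps G₁ G₂ q) (i : G₁) (j : G₂),
          (φ : G₁ → G₂) i = j ↔
            Costas.unitsMap (e φ : Polynomial F) (ψ₁ i) = ψ₂ j) := by
  subst hq
  constructor
  · intro φ hφ hord
    constructor
    · rintro ⟨f, -, ψ₁, -⟩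
      -- The unit group of a finite field is cyclic.
      exact isAddCyclic_of_surjective ψ₁.symm ψ₁.symm.surjective
    · intro hcyc
      obtain ⟨p, hchar⟩ := CharP.exists F
      have hpp : p.Prime := CharP.char_is_prime F p
      have : Fact p.Prime := ⟨hpp⟩
      have hdvd : p ∣ Nat.card G₂ := by
        rw [show Nat.card G₂ = Nat.card F from hord, ← CharP.cast_eq_zero_iff F p]
        cases nonempty_fintype F
        rw [Nat.card_eq_fintype_card]
        exact Nat.cast_card_eq_zero F
      obtain ⟨ψ₂⟩ := Costas.nonempty_addEquiv_of_nsmul_eq_zero (F := F) (p := p)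
        (hφ.nsmul_eq_zero hpp hdvd) hord
      have hcard : Nat.card G₁ = Nat.card (Additive Fˣ) := by
        have h1 := hφ.card_eq
        have h2 : Nat.card G₂ = Nat.card F := hord
        rw [Nat.card_congr (Additive.toMul (α := Fˣ)), Nat.card_units]
        omega
      let ψ₁ : G₁ ≃+ Additive Fˣ := addEquivOfAddCyclicCardEq hcard
      obtain ⟨f, hf, -, rfl⟩ := hφ.exists_isCostasPolynomial ψ₁ ψ₂
      refine ⟨f, hf, ψ₁, ψ₂, fun x y => ?_⟩
      exact ψ₂.toEquiv.symm_apply_eq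
  · intro ψ₁ ψ₂
    let T : Costas.costasPolynomials F (Nat.card F - 1) → Costas.standardMaps G₁ G₂ (Nat.card F) :=
      fun f => ⟨Costas.transportedMap ψ₁ ψ₂ f.1, f.2.1.isStandardCircularCostas ψ₁ ψ₂,
        Nat.card_congr ψ₂.toEquiv⟩
    have hT : Function.Bijective T := by
      constructor
      · rintro ⟨f, hf, hfd⟩ ⟨g, hg, hgd⟩ h
        have h1 : Costas.transportedMap ψ₁ ψ₂ f = Costas.transportedMap ψ₁ ψ₂ g :=
          congrArg Subtype.val h
        refine Subtype.ext (Costas.polynomial_ext_of_natDegree_le hfd hgd fun x => ?_)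
        rcases eq_or_ne x 0 with rfl | hx
        · exact hf.eval_zero.trans hg.eval_zero.symm
        -- The transported maps see only the units; the value at `0` is fixed by the Costas
        -- condition.
        · have h2 := ψ₂.symm.injective (congrFun h1 (ψ₁.symm (Additive.ofMul (Units.mk0 x hx))))
          simpa [Costas.unitsMap] using h2
      · rintro ⟨φ, hφ, hord⟩
        obtain ⟨f, hf, hfd, hfe⟩ := hφ.exists_isCostasPolynomial ψ₁ ψ₂
        exact ⟨⟨f, hf, hfd⟩, Subtype.ext hfe⟩
    refine ⟨(Equiv.ofBijective T hT).symm, fun φ i j => ?_⟩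
    obtain ⟨f, rfl⟩ := hT.2 φ
    rw [Equiv.ofBijective_symm_apply_apply]
    exact ψ₂.toEquiv.symm_apply_eq
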